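/- Let $H$ be a complex Hilbert space with scalar product $(\cdot,\cdot)$ (linear in the first argument), let $\mathcal L$ be a skew-adjoint operator in $H$ (densely defined, $\mathcal L^\dagger=-\mathcal L$), and let $z\in D(\mathcal L)$ with $z\neq 0$. Let $\mathcal P=(\cdot,z)(z,z)^{-1}z$ be the orthogonal projection onto the span of $z$, and $\mathcal Q=1-\mathcal P$. Then $\mathcal{QL}$ (with domain $D(\mathcal L)$) is closable, and $\overline{\mathcal{QL}}\,\mathcal Q$, with domain $\{x\in H:\mathcal Qx\in D(\overline{\mathcal{QL}})\}$, is the generator of a unique strongly continuous group $\{\mathcal G(t)\}_{t\in\mathbb R}$ of bounded operators on $H$; every $\mathcal G(t)$ is unitary. Here the generator of $\mathcal G$ is the operator $x\mapsto\lim_{h\searrow 0}h^{-1}(\mathcal G(h)x-x)$, defined for exactly those $x$ for which the limit exists in $H$. Moreover, the fluctuating forces $\eta_t:=\mathcal G(t)\mathcal{QL}z$ are stationary: $$(\eta_{t+r},\eta_{s+r})=(\eta_t,\eta_s)\qquad\text{for all } r,s,t\in\mathbb R.$$ -/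

import Mathlib

open Filter Topology
open scoped InnerProductSpace

noncomputable section

namespace MoriZwanzig

variable {H : Type*} [NormedAddCommGroup H] [InnerProductSpace ℂ H]

/-- The Mori projection `P x = (x, z) (z, z)⁻¹ z`. Mathlib's inner product is conjugate-linear in
its first argument, so `(x, y)` with conjugation in the second argument is `⟪y, x⟫_ℂ`. -/
def moriP (z : H) : H →L[ℂ] H :=
  (⟪z, z⟫_ℂ)⁻¹ • (innerSL ℂ z).smulRight z

/-- The complementary projection `Q = 1 - P`. -/
def moriQ (z : H) : H →L[ℂ] H := 1 - moriP z

/-- The product `A B` of an unbounded operator `A` with an everywhere defined bounded operator `B`,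
on its natural domain `{x | B x ∈ D(A)}`. -/
def compBounded (A : H →ₗ.[ℂ] H) (B : H →L[ℂ] H) : H →ₗ.[ℂ] H where
  domain := A.domain.comap (B : H →ₗ[ℂ] H)
  toFun := A.toFun ∘ₗ (B : H →ₗ[ℂ] H).submoduleComap A.domain

/-- The operator `Q L`, with domain `D(L)`. -/
def projectedGenerator (L : H →ₗ.[ℂ] H) (z : H) : H →ₗ.[ℂ] H :=
  (moriQ z : H →ₗ[ℂ] H).compPMap L

/-- The operator `closure (Q L) Q`. (Mathlib's `LinearPMap.closure` is the closure of the operator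
when the operator is closable.) -/
def orthogonalGenerator (L : H →ₗ.[ℂ] H) (z : H) : H →ₗ.[ℂ] H :=
  compBounded (projectedGenerator L z).closure (moriQ z)

/-- `L` is skew-adjoint: densely defined with `L† = -L`, domains included. -/
def IsSkewAdjoint [CompleteSpace H] (L : H →ₗ.[ℂ] H) : Prop :=
  Dense (L.domain : Set H) ∧ L.adjoint = -L

/-- `G` is a strongly continuous one-parameter group of bounded operators on `H`. -/
structure IsStronglyContinuousGroup (G : ℝ → H →L[ℂ] H) : Prop where
  map_zero : G 0 = 1
  map_add : ∀ s t : ℝ, G (s + t) = G s ∘L G t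
  continuous_orbit : ∀ x : H, Continuous fun t : ℝ => G t x

/-- `A` is the generator of `G`: `x ∈ D(A)` and `A x = y` exactly when `h⁻¹ (G(h) x - x)` converges
to `y` as `h ↘ 0`. -/
def IsGeneratorOf (A : H →ₗ.[ℂ] H) (G : ℝ → H →L[ℂ] H) : Prop :=
  ∀ x y : H, (x, y) ∈ A.graph ↔ Tendsto (fun h : ℝ => h⁻¹ • (G h x - x)) (𝓝[>] 0) (𝓝 y)

/-- The fluctuating force `η_t = G(t) Q L z`. -/
def fluctuatingForce (L : H →ₗ.[ℂ] H) (z : L.domain) (G : ℝ → H →L[ℂ] H) (t : ℝ) : H :=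
  G t (moriQ (z : H) (L z))

end MoriZwanzig

end

/-!
`P L` is bounded on `D(L)`: as `L` is skew-adjoint and `z ∈ D(L)`, it is `x ↦ -(x, L z) (z, z)⁻¹ z`.
So `Q L` differs from the closed operator `L` by a bounded operator and is closed on `D(L)`
(`isClosed_projectedGenerator`). Since `z ∈ D(L)`, the natural domain of `Q L Q` is again `D(L)`,
where it is the sum of `L` and a bounded skew-adjoint operator, hence skew-adjoint
(`isSkewAdjoint_orthogonalGenerator`).

The rest is Stone's theorem for a skew-adjoint operator `A`. Skew-adjointness is used as a property
of the graph (`isSkewAdjoint_iff_mem_graph`). It gives resolvents at all nonzero real points, and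
the bounded operators `B n = n² A (n² - A²)⁻¹ = (n² / 2) ((n - A)⁻¹ + (-n - A)⁻¹)` are skew-adjoint,
commute, and converge strongly to `A` on `D(A)`. The estimate
`‖exp (t B) x - exp (t C) x‖ ≤ |t| ‖B x - C x‖` for commuting bounded skew-adjoint `B`, `C` shows
that the unitary groups `exp (t B n)` converge strongly, for all real `t`, to a unitary group
`expGroup`. Its generator extends `A` by a quantitative bound on the difference quotients of
`exp (t B n)` (`norm_exp_smul_sub_sub_le`), and is no larger because it is skew-symmetric against
`A` and `A` is skew-adjoint (`isGeneratorOf_expGroup`). Another group with the same generator agrees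
with it because the difference `u` of two orbits satisfies `u' = A u` from the right, so `‖u‖²` is
constant (`IsSkewAdjoint.group_unique`).

Stationarity of the fluctuating forces is the group law together with unitarity.
-/

open Filter Topology
open scoped InnerProductSpace

noncomputable section

namespace MoriZwanzig

variable {H : Type*} [NormedAddCommGroup H] [InnerProductSpace ℂ H] [CompleteSpace H]
  {A : H →ₗ.[ℂ] H}

/-! ### Skew-adjoint operators through their graphs -/

/-- An operator is skew-adjoint exactly when its graph is its own annihilator for the form
`⟪y, u⟫ + ⟪x, v⟫` on pairs `(x, y)`, `(u, v)`. -/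
theorem isSkewAdjoint_iff_mem_graph : IsSkewAdjoint A ↔ Dense (A.domain : Set H) ∧
    ∀ x y : H, (x, y) ∈ A.graph ↔ ∀ u v, (u, v) ∈ A.graph → ⟪y, u⟫_ℂ = -⟪x, v⟫_ℂ := by
  refine and_congr_right fun hd => ?_
  have hneg : ∀ x y : H, (x, y) ∈ (-A).graph ↔ (x, -y) ∈ A.graph := by
    intro x y
    simp [LinearPMap.mem_graph_iff, neg_eq_iff_eq_neg]
  have hadj : ∀ x y : H, (x, y) ∈ A.adjoint.graph ↔
      ∀ u v, (u, v) ∈ A.graph → ⟪-y, u⟫_ℂ = -⟪x, v⟫_ℂ := by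
    intro x y
    rw [LinearPMap.adjoint_graph_eq_graph_adjoint hd, Submodule.mem_adjoint_iff]
    refine forall₃_congr fun u v _ => ?_
    rw [inner_neg_left, neg_inj, sub_eq_zero, ← inner_conj_symm y u, ← inner_conj_symm x v,
      (starRingEnd ℂ).injective.eq_iff, eq_comm]
  constructor
  · intro h x y
    have h' := hadj x (-y)
    rw [h, hneg, neg_neg] at h'
    exact h'
  · intro h
    refine LinearPMap.eq_of_eq_graph (Submodule.ext fun p => ?_)
    obtain ⟨x, y⟩ := p
    rw [hadj, hneg, h]

namespace IsSkewAdjoint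

variable (hA : IsSkewAdjoint A)
include hA

theorem dense_domain : Dense (A.domain : Set H) := hA.1

theorem mem_graph_iff {x y : H} :
    (x, y) ∈ A.graph ↔ ∀ u v, (u, v) ∈ A.graph → ⟪y, u⟫_ℂ = -⟪x, v⟫_ℂ :=
  (isSkewAdjoint_iff_mem_graph.1 hA).2 x y

theorem inner_eq_neg {x y u v : H} (hx : (x, y) ∈ A.graph) (hu : (u, v) ∈ A.graph) :
    ⟪y, u⟫_ℂ = -⟪x, v⟫_ℂ :=
  hA.mem_graph_iff.1 hx u v hu

theorem re_inner_eq_zero {x y : H} (hx : (x, y) ∈ A.graph) : (⟪x, y⟫_ℂ).re = 0 := by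
  have h := congrArg Complex.re (hA.inner_eq_neg hx hx)
  rw [← inner_conj_symm] at h
  simp only [Complex.conj_re, Complex.neg_re] at h
  linarith

theorem isClosed_graph : IsClosed (A.graph : Set (H × H)) := by
  have : (A.graph : Set (H × H)) =
      ⋂ p : A.graph, {q : H × H | ⟪q.2, p.1.1⟫_ℂ = -⟪q.1, p.1.2⟫_ℂ} := by
    ext ⟨x, y⟩
    rw [SetLike.mem_coe, hA.mem_graph_iff, Set.mem_iInter]
    exact ⟨fun h p => h _ _ p.2, fun h u v huv => h ⟨(u, v), huv⟩⟩
  rw [this]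
  exact isClosed_iInter fun p => isClosed_eq (by fun_prop) (by fun_prop)

/-- For real `c` the cross term of `‖c x - A x‖²` vanishes. -/
theorem norm_smul_sub_sq (c : ℝ) {x y : H} (hx : (x, y) ∈ A.graph) :
    ‖(c : ℂ) • x - y‖ ^ 2 = c ^ 2 * ‖x‖ ^ 2 + ‖y‖ ^ 2 := by
  rw [@norm_sub_sq ℂ, norm_smul, inner_smul_left]
  simp [hA.re_inner_eq_zero hx, mul_pow]

/-! ### Resolvents at real points -/

/-- The resolvent `R = (c - A)⁻¹` at a nonzero real `c`, with its two defining properties. -/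
theorem exists_resolvent {c : ℝ} (hc : c ≠ 0) : ∃ R : H →L[ℂ] H,
    (∀ x, (R x, (c : ℂ) • R x - x) ∈ A.graph) ∧
    ∀ x y, (x, y) ∈ A.graph → R ((c : ℂ) • x - y) = x := by
  have : CompleteSpace A.graph := hA.isClosed_graph.completeSpace_coe
  set T : A.graph →L[ℂ] H :=
    ((c : ℂ) • ContinuousLinearMap.fst ℂ H H - ContinuousLinearMap.snd ℂ H H) ∘L A.graph.subtypeL
    with hT
  have hTapp : ∀ p : A.graph, T p = (c : ℂ) • p.1.1 - p.1.2 := fun p => rfl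
  have hc2 : 0 < c ^ 2 := by positivity
  -- `‖T p‖²` dominates a multiple of `‖p‖²`, so `T` is injective with closed range.
  have hbound : ∀ p : A.graph, ‖p‖ ≤ (Real.sqrt (1 / c ^ 2 + 1)) * ‖T p‖ := by
    rintro ⟨⟨x, y⟩, hp⟩
    have key := hA.norm_smul_sub_sq c hp
    have hx : ‖x‖ ^ 2 ≤ (1 / c ^ 2 + 1) * ‖(c : ℂ) • x - y‖ ^ 2 := by
      rw [key]
      have : (1 / c ^ 2 + 1) * (c ^ 2 * ‖x‖ ^ 2 + ‖y‖ ^ 2) =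
        ‖x‖ ^ 2 + c ^ 2 * ‖x‖ ^ 2 + ‖y‖ ^ 2 * (1 / c ^ 2 + 1) := by field_simp
      rw [this]
      have := sq_nonneg ‖x‖
      have h3 : 0 ≤ ‖y‖ ^ 2 * (1 / c ^ 2 + 1) := by positivity
      nlinarith
    have hy : ‖y‖ ^ 2 ≤ (1 / c ^ 2 + 1) * ‖(c : ℂ) • x - y‖ ^ 2 := by
      rw [key]
      have h3 : 0 ≤ 1 / c ^ 2 * (c ^ 2 * ‖x‖ ^ 2 + ‖y‖ ^ 2) := by positivity
      have h4 : 0 ≤ c ^ 2 * ‖x‖ ^ 2 := by positivity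
      linarith
    have hsq : ∀ w : H, ‖w‖ ^ 2 ≤ (1 / c ^ 2 + 1) * ‖(c : ℂ) • x - y‖ ^ 2 →
        ‖w‖ ≤ Real.sqrt (1 / c ^ 2 + 1) * ‖(c : ℂ) • x - y‖ := by
      intro w hw
      refine abs_le_of_sq_le_sq' ?_ (by positivity) |>.2
      rwa [mul_pow, Real.sq_sqrt (by positivity)]
    exact max_le (hsq x hx) (hsq y hy)
  have hanti : AntilipschitzWith (Real.sqrt (1 / c ^ 2 + 1)).toNNReal T :=
    T.antilipschitz_of_bound fun p => by
      rw [Real.coe_toNNReal _ (Real.sqrt_nonneg _)]; exact hbound p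
  have hker : T.ker = ⊥ := LinearMap.ker_eq_bot.2 hanti.injective
  have hclosed : IsClosed (T.range : Set H) := by
    rw [LinearMap.coe_range]
    exact hanti.isClosed_range T.uniformContinuous
  have hrange : T.range = ⊤ := by
    have := hclosed.completeSpace_coe
    rw [← Submodule.orthogonal_eq_bot_iff, Submodule.eq_bot_iff]
    intro v hv
    rw [Submodule.mem_orthogonal] at hv
    -- A vector `v` orthogonal to the range satisfies `A v = -c v`, and `Re (v, A v) = 0` kills it.
    have hv' : (v, (-c : ℂ) • v) ∈ A.graph := by
      rw [hA.mem_graph_iff]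
      intro u w huw
      have h0 := hv _ (LinearMap.mem_range_self T.toLinearMap ⟨(u, w), huw⟩)
      have h1 : ⟪(c : ℂ) • u - w, v⟫_ℂ = 0 := h0
      have h2 : ⟪v, (c : ℂ) • u - w⟫_ℂ = 0 := inner_eq_zero_symm.1 h1
      rw [inner_sub_right, inner_smul_right, sub_eq_zero] at h2
      rw [inner_smul_left, ← h2]
      simp
    have h3 := hA.re_inner_eq_zero hv'
    rw [inner_smul_right, inner_self_eq_norm_sq_to_K] at h3
    have h4 : c * ‖v‖ ^ 2 = 0 := by
      have : ((-c : ℂ) * ((‖v‖ : ℝ) : ℂ) ^ 2).re = -(c * ‖v‖ ^ 2) := by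
        rw [← Complex.ofReal_pow, ← Complex.ofReal_neg, ← Complex.ofReal_mul, Complex.ofReal_re]
        ring
      have h5 := this.symm.trans h3
      linarith
    simpa [hc] using h4
  set e := ContinuousLinearEquiv.ofBijective T hker hrange with he
  have hTe : ∀ p, e p = T p := fun p => rfl
  refine ⟨ContinuousLinearMap.fst ℂ H H ∘L A.graph.subtypeL ∘L e.symm.toContinuousLinearMap,
    fun x => ?_, fun x y hxy => ?_⟩
  · have h1 : T (e.symm x) = x := by rw [← hTe, e.apply_symm_apply]
    have h2 : (e.symm x).1.2 = (c : ℂ) • (e.symm x).1.1 - x := by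
      nth_rw 3 [← h1]
      rw [hTapp]; abel
    have h3 := (e.symm x).2
    change ((e.symm x).1.1, (c : ℂ) • (e.symm x).1.1 - x) ∈ A.graph
    rw [← h2]
    exact h3
  · have : e.symm ((c : ℂ) • x - y) = ⟨(x, y), hxy⟩ := by
      rw [e.symm_apply_eq, hTe, hTapp]
    change (e.symm ((c : ℂ) • x - y)).1.1 = x
    rw [this]

/-- The resolvent `(c - A)⁻¹` of a skew-adjoint operator at a real `c`, with the value `0` at
`c = 0`, where the resolvent need not exist. -/
def resolvent (c : ℝ) : H →L[ℂ] H :=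
  if hc : c ≠ 0 then (hA.exists_resolvent hc).choose else 0

theorem resolvent_mem_graph {c : ℝ} (hc : c ≠ 0) (x : H) :
    (hA.resolvent c x, (c : ℂ) • hA.resolvent c x - x) ∈ A.graph := by
  rw [resolvent, dif_pos hc]
  exact (hA.exists_resolvent hc).choose_spec.1 x

theorem resolvent_smul_sub {c : ℝ} (hc : c ≠ 0) {x y : H} (hx : (x, y) ∈ A.graph) :
    hA.resolvent c ((c : ℂ) • x - y) = x := by
  rw [resolvent, dif_pos hc]
  exact (hA.exists_resolvent hc).choose_spec.2 x y hx

theorem norm_resolvent_le {c : ℝ} (hc : c ≠ 0) (x : H) : ‖hA.resolvent c x‖ ≤ |c|⁻¹ * ‖x‖ := by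
  have h := hA.norm_smul_sub_sq c (hA.resolvent_mem_graph hc x)
  rw [sub_sub_cancel] at h
  rw [inv_mul_eq_div, le_div_iff₀ (abs_pos.2 hc), mul_comm]
  refine abs_le_of_sq_le_sq' ?_ (norm_nonneg _) |>.2
  rw [mul_pow, sq_abs, h]
  have := sq_nonneg ‖(c : ℂ) • hA.resolvent c x - x‖
  linarith

theorem resolvent_smul_eq {c : ℝ} (hc : c ≠ 0) {x y : H} (hx : (x, y) ∈ A.graph) :
    (c : ℂ) • hA.resolvent c x = x + hA.resolvent c y := by
  have h := hA.resolvent_smul_sub hc hx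
  rw [map_sub, map_smul, sub_eq_iff_eq_add] at h
  exact h

theorem resolvent_identity {c d : ℝ} (hc : c ≠ 0) (hd : d ≠ 0) (x : H) :
    ((c : ℂ) - d) • hA.resolvent c (hA.resolvent d x) = hA.resolvent d x - hA.resolvent c x := by
  have h := hA.resolvent_smul_eq hc (hA.resolvent_mem_graph hd x)
  rw [map_sub, map_smul] at h
  rw [sub_smul, h]
  abel

theorem resolvent_commute {c d : ℝ} (hc : c ≠ 0) (hd : d ≠ 0) :
    Commute (hA.resolvent c) (hA.resolvent d) := by
  rcases eq_or_ne c d with rfl | hcd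
  · exact Commute.refl _
  ext x
  have hne : (c : ℂ) - d ≠ 0 := sub_ne_zero.2 (by exact_mod_cast hcd)
  refine smul_right_injective H hne ?_
  have h1 := hA.resolvent_identity hc hd x
  have h2 := hA.resolvent_identity hd hc x
  change ((c : ℂ) - d) • hA.resolvent c (hA.resolvent d x) =
    ((c : ℂ) - d) • hA.resolvent d (hA.resolvent c x)
  rw [h1, ← neg_sub (d : ℂ) c, neg_smul, h2, neg_sub]

theorem star_resolvent {c : ℝ} (hc : c ≠ 0) :
    star (hA.resolvent c) = -hA.resolvent (-c) := by
  rw [ContinuousLinearMap.star_eq_adjoint, eq_comm, ContinuousLinearMap.eq_adjoint_iff]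
  intro x y
  have h := hA.inner_eq_neg (hA.resolvent_mem_graph (neg_ne_zero.2 hc) x)
    (hA.resolvent_mem_graph hc y)
  rw [inner_sub_left, inner_sub_right, inner_smul_left, inner_smul_right] at h
  simp only [Complex.ofReal_neg, map_neg, Complex.conj_ofReal] at h
  rw [neg_apply, inner_neg_left]
  linear_combination h

/-! ### The symmetrised Yosida approximation -/

/-- The bounded operators `(n² / 2) ((n - A)⁻¹ + (-n - A)⁻¹) = n² A (n² - A²)⁻¹`, indexed so that
`n = k + 1` is nonzero. -/
def yosida (k : ℕ) : H →L[ℂ] H :=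
  (((k : ℂ) + 1) ^ 2 / 2) • (hA.resolvent (k + 1) + hA.resolvent (-(k + 1)))

theorem star_yosida (k : ℕ) : star (hA.yosida k) = -hA.yosida k := by
  have hk : (k : ℝ) + 1 ≠ 0 := Nat.cast_add_one_ne_zero k
  have h2 := hA.star_resolvent (neg_ne_zero.2 hk)
  rw [neg_neg] at h2
  rw [yosida, star_smul, star_add, hA.star_resolvent hk, h2, ← neg_add, smul_neg,
    add_comm (hA.resolvent (-_)), neg_inj]
  simp

theorem yosida_commute (k l : ℕ) : Commute (hA.yosida k) (hA.yosida l) := by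
  have hk : (k : ℝ) + 1 ≠ 0 := Nat.cast_add_one_ne_zero k
  have hl : (l : ℝ) + 1 ≠ 0 := Nat.cast_add_one_ne_zero l
  have hk' := neg_ne_zero.2 hk
  have hl' := neg_ne_zero.2 hl
  refine Commute.smul_left (Commute.smul_right ?_ _) _
  exact ((hA.resolvent_commute hk hl).add_right (hA.resolvent_commute hk hl')).add_left
    ((hA.resolvent_commute hk' hl).add_right (hA.resolvent_commute hk' hl'))

/-- `c (c - A)⁻¹ → 1` strongly as `|c| → ∞`. -/
theorem tendsto_smul_resolvent {c : ℕ → ℝ} (hc0 : ∀ k, c k ≠ 0)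
    (hc : Tendsto (fun k => |c k|⁻¹) atTop (𝓝 0)) (x : H) :
    Tendsto (fun k => (c k : ℂ) • hA.resolvent (c k) x) atTop (𝓝 x) := by
  have hcontr : ∀ k y, ‖(c k : ℂ) • hA.resolvent (c k) y‖ ≤ ‖y‖ := by
    intro k y
    rw [norm_smul, Complex.norm_real, Real.norm_eq_abs]
    calc |c k| * ‖hA.resolvent (c k) y‖ ≤ |c k| * (|c k|⁻¹ * ‖y‖) := by
          gcongr; exact hA.norm_resolvent_le (hc0 k) y
      _ = ‖y‖ := by rw [mul_inv_cancel_left₀ (abs_ne_zero.2 (hc0 k))]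
  rw [Metric.tendsto_atTop]
  intro ε hε
  obtain ⟨u, hu, hxu⟩ := Metric.mem_closure_iff.1 (hA.dense_domain x) (ε / 3) (by positivity)
  have hlim : Tendsto (fun k => |c k|⁻¹ * ‖A ⟨u, hu⟩‖) atTop (𝓝 0) := by
    simpa using hc.mul_const ‖A ⟨u, hu⟩‖
  have hsmall := hlim.eventually (gt_mem_nhds (show (0 : ℝ) < ε / 3 by positivity))
  obtain ⟨N, hN⟩ := hsmall.exists_forall_of_atTop
  refine ⟨N, fun k hk => ?_⟩
  have h1 := hA.resolvent_smul_eq (hc0 k) (A.mem_graph ⟨u, hu⟩)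
  have h2 : (c k : ℂ) • hA.resolvent (c k) x - x =
      (c k : ℂ) • hA.resolvent (c k) (x - u) + hA.resolvent (c k) (A ⟨u, hu⟩) - (x - u) := by
    rw [map_sub, smul_sub, h1]; simp only; abel
  rw [dist_eq_norm] at hxu ⊢
  rw [h2]
  have h3 := norm_sub_le ((c k : ℂ) • hA.resolvent (c k) (x - u) +
    hA.resolvent (c k) (A ⟨u, hu⟩)) (x - u)
  have h4 := norm_add_le ((c k : ℂ) • hA.resolvent (c k) (x - u))
    (hA.resolvent (c k) (A ⟨u, hu⟩))
  have h5 := hcontr k (x - u)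
  have h6 := hA.norm_resolvent_le (hc0 k) (A ⟨u, hu⟩)
  have h7 := hN k hk
  linarith

/-- Since `c² R x = c x + c R (A x)` for `R = (c - A)⁻¹`, the terms `± n x` cancel in the average
over `c = ± n`, which leaves the mean of `± n (± n - A)⁻¹ (A x)`. -/
theorem tendsto_yosida {x y : H} (hx : (x, y) ∈ A.graph) :
    Tendsto (fun k => hA.yosida k x) atTop (𝓝 y) := by
  have hc : Tendsto (fun k : ℕ => |(k : ℝ) + 1|⁻¹) atTop (𝓝 0) := by
    refine tendsto_inv_atTop_zero.comp (tendsto_abs_atTop_atTop.comp ?_)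
    exact tendsto_atTop_add_const_right _ _ tendsto_natCast_atTop_atTop
  have hp := hA.tendsto_smul_resolvent Nat.cast_add_one_ne_zero hc y
  have hm := hA.tendsto_smul_resolvent (c := fun k => -((k : ℝ) + 1))
    (fun k => neg_ne_zero.2 (Nat.cast_add_one_ne_zero k)) (by simpa only [abs_neg] using hc) y
  have h := (hp.add hm).const_smul (1 / 2 : ℂ)
  have hy : (1 / 2 : ℂ) • (y + y) = y := by rw [← two_smul ℂ y, smul_smul]; norm_num
  rw [hy] at h
  refine h.congr fun k => ?_
  have hk : (k : ℝ) + 1 ≠ 0 := Nat.cast_add_one_ne_zero k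
  have h1 := hA.resolvent_smul_eq hk hx
  have h2 := hA.resolvent_smul_eq (neg_ne_zero.2 hk) hx
  have e1 := eq_sub_of_add_eq' h1.symm
  have e2 := eq_sub_of_add_eq' h2.symm
  rw [e1, e2, yosida, smul_apply, add_apply]
  push_cast
  module

end IsSkewAdjoint
/-! ### Exponentials of bounded skew-adjoint operators -/

section BoundedSkew

variable {B C : H →L[ℂ] H}

theorem star_exp_smul (hB : star B = -B) (t : ℝ) :
    star (NormedSpace.exp (t • B)) = NormedSpace.exp ((-t) • B) := by
  rw [NormedSpace.star_exp, star_smul, hB, star_trivial, smul_neg, neg_smul]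

theorem exp_add_smul (B : H →L[ℂ] H) (s t : ℝ) :
    NormedSpace.exp ((s + t) • B) = NormedSpace.exp (s • B) * NormedSpace.exp (t • B) := by
  let := NormedAlgebra.restrictScalars ℚ ℝ (H →L[ℂ] H)
  rw [add_smul]
  exact NormedSpace.exp_add_of_commute (((Commute.refl B).smul_left s).smul_right t)

theorem norm_exp_smul_apply (hB : star B = -B) (t : ℝ) (x : H) :
    ‖NormedSpace.exp (t • B) x‖ = ‖x‖ := by
  let := NormedAlgebra.restrictScalars ℚ ℝ (H →L[ℂ] H)
  refine ContinuousLinearMap.norm_map_of_mem_unitary ?_ x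
  refine NormedSpace.exp_mem_unitary_of_mem_skewAdjoint (skewAdjoint.mem_iff.2 ?_)
  rw [star_smul, hB, star_trivial, smul_neg]

theorem hasDerivAt_exp_smul_apply (B : H →L[ℂ] H) (x : H) (t : ℝ) :
    HasDerivAt (fun t : ℝ => NormedSpace.exp (t • B) x) (NormedSpace.exp (t • B) (B x)) t := by
  have h := hasDerivAt_exp_smul_const (𝕂 := ℝ) B t
  exact ((ContinuousLinearMap.apply ℂ H x).restrictScalars ℝ).hasFDerivAt.comp_hasDerivAt t h

theorem norm_exp_smul_sub_le (hB : star B = -B) (t : ℝ) (x : H) :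
    ‖NormedSpace.exp (t • B) x - x‖ ≤ |t| * ‖B x‖ := by
  have h := Convex.norm_image_sub_le_of_norm_hasDerivWithin_le (x := 0) (y := t) (C := ‖B x‖)
    (fun s _ => (hasDerivAt_exp_smul_apply B x s).hasDerivWithinAt)
    (fun s _ => (norm_exp_smul_apply hB s (B x)).le) convex_univ (Set.mem_univ _) (Set.mem_univ _)
  simpa [NormedSpace.exp_zero, mul_comm] using h

/-- The difference quotient of `exp (t B)` at `x`, compared with `B x`. The auxiliary vector `w`
makes the bound depend on `B` only through `B x` and `B w`, so that it survives a strong limit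
of operators `B`. -/
theorem norm_exp_smul_sub_sub_le (hB : star B = -B) {t : ℝ} (ht : 0 ≤ t) (x w : H) :
    ‖NormedSpace.exp (t • B) x - x - t • B x‖ ≤ t * (2 * ‖B x - w‖ + t * ‖B w‖) := by
  have h := Convex.norm_image_sub_le_of_norm_hasDerivWithin_le (s := Set.Icc 0 t) (x := 0) (y := t)
    (f := fun s => NormedSpace.exp (s • B) x - s • B x)
    (f' := fun s => NormedSpace.exp (s • B) (B x) - (1 : ℝ) • B x)
    (C := 2 * ‖B x - w‖ + t * ‖B w‖)
    (fun s _ => ((hasDerivAt_exp_smul_apply B x s).sub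
      ((hasDerivAt_id s).smul_const (B x))).hasDerivWithinAt)
    (fun s hs => ?_) (convex_Icc 0 t) ⟨le_rfl, ht⟩ ⟨ht, le_rfl⟩
  · have e : NormedSpace.exp (t • B) x - t • B x - (NormedSpace.exp ((0 : ℝ) • B) x - (0 : ℝ) • B x)
        = NormedSpace.exp (t • B) x - x - t • B x := by
      rw [zero_smul, zero_smul, NormedSpace.exp_zero, one_apply_eq_self]; abel
    rw [e, sub_zero, Real.norm_of_nonneg ht, mul_comm] at h
    exact h
  · have e : NormedSpace.exp (s • B) (B x) - (1 : ℝ) • B x =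
        NormedSpace.exp (s • B) (B x - w) + (NormedSpace.exp (s • B) w - w) - (B x - w) := by
      rw [one_smul, map_sub]; abel
    have h1 := norm_exp_smul_apply hB s (B x - w)
    have h2 := norm_exp_smul_sub_le hB s w
    rw [abs_of_nonneg hs.1] at h2
    have h3 : s * ‖B w‖ ≤ t * ‖B w‖ := by gcongr; exact hs.2
    have h4 := norm_sub_le (NormedSpace.exp (s • B) (B x - w) + (NormedSpace.exp (s • B) w - w))
      (B x - w)
    have h5 := norm_add_le (NormedSpace.exp (s • B) (B x - w)) (NormedSpace.exp (s • B) w - w)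
    rw [e]
    linarith

theorem norm_exp_smul_sub_exp_smul_le (hB : star B = -B) (hC : star C = -C) (hBC : Commute B C)
    (t : ℝ) (x : H) :
    ‖NormedSpace.exp (t • B) x - NormedSpace.exp (t • C) x‖ ≤ |t| * ‖B x - C x‖ := by
  let := NormedAlgebra.restrictScalars ℚ ℝ (H →L[ℂ] H)
  have hcomm : Commute (t • C) (t • (B - C)) :=
    ((hBC.symm.sub_right (Commute.refl C)).smul_left t).smul_right t
  have e : t • B = t • C + t • (B - C) := by rw [← smul_add, add_sub_cancel]
  have hskew : star (B - C) = -(B - C) := by rw [star_sub, hB, hC]; abel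
  rw [e, NormedSpace.exp_add_of_commute hcomm, mul_apply_eq_comp, ← map_sub,
    norm_exp_smul_apply hC]
  exact norm_exp_smul_sub_le hskew t x

end BoundedSkew

/-! ### The unitary group of a skew-adjoint operator -/

namespace IsSkewAdjoint

variable (hA : IsSkewAdjoint A)
include hA

/-- On `D(A)` this is the estimate for commuting generators; it extends to all of `H` because the
exponentials are isometries. -/
theorem exists_tendsto_exp_yosida (t : ℝ) (x : H) :
    ∃ y, Tendsto (fun k => NormedSpace.exp (t • hA.yosida k) x) atTop (𝓝 y) := by
  refine cauchySeq_tendsto_of_complete (Metric.cauchySeq_iff.2 fun ε hε => ?_)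
  obtain ⟨u, hu, hxu⟩ := Metric.mem_closure_iff.1 (hA.dense_domain x) (ε / 3) (by positivity)
  have hcau := (hA.tendsto_yosida (A.mem_graph ⟨u, hu⟩)).cauchySeq
  obtain ⟨N, hN⟩ := Metric.cauchySeq_iff.1 hcau (ε / 3 / (|t| + 1)) (by positivity)
  refine ⟨N, fun m hm n hn => ?_⟩
  rw [dist_eq_norm] at hxu ⊢
  have h1 := norm_exp_smul_sub_exp_smul_le (hA.star_yosida m) (hA.star_yosida n)
    (hA.yosida_commute m n) t u
  have h2 := hN m hm n hn
  rw [dist_eq_norm, lt_div_iff₀ (by positivity)] at h2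
  simp only at h1 h2
  have hm' := norm_exp_smul_apply (hA.star_yosida m) t (x - u)
  have hn' := norm_exp_smul_apply (hA.star_yosida n) t (x - u)
  have e : NormedSpace.exp (t • hA.yosida m) x - NormedSpace.exp (t • hA.yosida n) x =
      NormedSpace.exp (t • hA.yosida m) (x - u) +
      (NormedSpace.exp (t • hA.yosida m) u - NormedSpace.exp (t • hA.yosida n) u) -
      NormedSpace.exp (t • hA.yosida n) (x - u) := by
    rw [map_sub, map_sub]; abel
  have h4 := norm_sub_le (NormedSpace.exp (t • hA.yosida m) (x - u) +
      (NormedSpace.exp (t • hA.yosida m) u - NormedSpace.exp (t • hA.yosida n) u))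
      (NormedSpace.exp (t • hA.yosida n) (x - u))
  have h5 := norm_add_le (NormedSpace.exp (t • hA.yosida m) (x - u))
      (NormedSpace.exp (t • hA.yosida m) u - NormedSpace.exp (t • hA.yosida n) u)
  have h6 := norm_nonneg (hA.yosida m u - hA.yosida n u)
  rw [e]
  nlinarith

/-- The group `exp (t A)`, as the strong limit of the exponentials of the Yosida
approximations. -/
def expGroup (t : ℝ) : H →L[ℂ] H :=
  continuousLinearMapOfTendsto (fun k => NormedSpace.exp (t • hA.yosida k))
    (f := fun x => (hA.exists_tendsto_exp_yosida t x).choose)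
    (tendsto_pi_nhds.2 fun x => (hA.exists_tendsto_exp_yosida t x).choose_spec)

theorem tendsto_expGroup (t : ℝ) (x : H) :
    Tendsto (fun k => NormedSpace.exp (t • hA.yosida k) x) atTop (𝓝 (hA.expGroup t x)) :=
  (hA.exists_tendsto_exp_yosida t x).choose_spec

theorem norm_expGroup_apply (t : ℝ) (x : H) : ‖hA.expGroup t x‖ = ‖x‖ :=
  tendsto_nhds_unique (hA.tendsto_expGroup t x).norm
    (tendsto_const_nhds.congr fun k => (norm_exp_smul_apply (hA.star_yosida k) t x).symm)

theorem expGroup_zero : hA.expGroup 0 = 1 := by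
  ext x
  refine tendsto_nhds_unique (hA.tendsto_expGroup 0 x) (tendsto_const_nhds.congr fun k => ?_)
  rw [zero_smul, NormedSpace.exp_zero]

theorem expGroup_add (s t : ℝ) : hA.expGroup (s + t) = hA.expGroup s ∘L hA.expGroup t := by
  ext x
  refine tendsto_nhds_unique (hA.tendsto_expGroup (s + t) x) ?_
  have h1 := hA.tendsto_expGroup s (hA.expGroup t x)
  -- The exponentials are isometries, so an argument tending to `0` may vary with `k`.
  have h2 : Tendsto (fun k => NormedSpace.exp (s • hA.yosida k)
      (NormedSpace.exp (t • hA.yosida k) x - hA.expGroup t x)) atTop (𝓝 0) := by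
    rw [tendsto_zero_iff_norm_tendsto_zero]
    simp_rw [norm_exp_smul_apply (hA.star_yosida _)]
    exact tendsto_iff_norm_sub_tendsto_zero.1 (hA.tendsto_expGroup t x)
  have h3 := h2.add h1
  rw [zero_add] at h3
  refine h3.congr fun k => ?_
  rw [exp_add_smul, mul_apply_eq_comp, map_sub, sub_add_cancel]

theorem star_expGroup (t : ℝ) : star (hA.expGroup t) = hA.expGroup (-t) := by
  rw [ContinuousLinearMap.star_eq_adjoint, eq_comm, ContinuousLinearMap.eq_adjoint_iff]
  intro x y
  refine tendsto_nhds_unique ((hA.tendsto_expGroup (-t) x).inner tendsto_const_nhds)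
    (((tendsto_const_nhds (x := x)).inner (hA.tendsto_expGroup t y)).congr fun k => ?_)
  rw [← star_exp_smul (hA.star_yosida k), ContinuousLinearMap.star_eq_adjoint,
    ContinuousLinearMap.adjoint_inner_left]

theorem expGroup_mem_unitary (t : ℝ) : hA.expGroup t ∈ unitary (H →L[ℂ] H) := by
  rw [Unitary.mem_iff, star_expGroup]
  constructor
  · have h := hA.expGroup_add (-t) t
    rw [neg_add_cancel, expGroup_zero] at h
    exact h.symm
  · have h := hA.expGroup_add t (-t)
    rw [add_neg_cancel, expGroup_zero] at h
    exact h.symm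

theorem norm_expGroup_sub_le (t : ℝ) {x y : H} (hx : (x, y) ∈ A.graph) :
    ‖hA.expGroup t x - x‖ ≤ |t| * ‖y‖ :=
  le_of_tendsto_of_tendsto' ((hA.tendsto_expGroup t x).sub_const x).norm
    ((hA.tendsto_yosida hx).norm.const_mul |t|)
    fun k => norm_exp_smul_sub_le (hA.star_yosida k) t x

theorem norm_expGroup_sub_sub_le {t : ℝ} (ht : 0 ≤ t) {x y w v : H} (hx : (x, y) ∈ A.graph)
    (hw : (w, v) ∈ A.graph) :
    ‖hA.expGroup t x - x - t • y‖ ≤ t * (2 * ‖y - w‖ + t * ‖v‖) := by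
  have hy := hA.tendsto_yosida hx
  have hv := hA.tendsto_yosida hw
  exact le_of_tendsto_of_tendsto'
    (((hA.tendsto_expGroup t x).sub_const x).sub (hy.const_smul t)).norm
    ((((hy.sub_const w).norm.const_mul 2).add (hv.norm.const_mul t)).const_mul t)
    fun k => norm_exp_smul_sub_sub_le (hA.star_yosida k) ht x w

theorem tendsto_expGroup_zero (x : H) : Tendsto (fun t => hA.expGroup t x) (𝓝 0) (𝓝 x) := by
  rw [Metric.tendsto_nhds]
  intro ε hε
  obtain ⟨u, hu, hxu⟩ := Metric.mem_closure_iff.1 (hA.dense_domain x) (ε / 3) (by positivity)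
  have hlim : Tendsto (fun t : ℝ => |t| * ‖A ⟨u, hu⟩‖) (𝓝 0) (𝓝 0) := by
    have : Continuous fun t : ℝ => |t| * ‖A ⟨u, hu⟩‖ := by fun_prop
    simpa using this.tendsto 0
  filter_upwards [hlim.eventually (gt_mem_nhds (show (0 : ℝ) < ε / 3 by positivity))] with t ht
  have h1 := hA.norm_expGroup_sub_le t (A.mem_graph ⟨u, hu⟩)
  have h2 := hA.norm_expGroup_apply t (x - u)
  rw [dist_eq_norm] at hxu ⊢
  have e : hA.expGroup t x - x = hA.expGroup t (x - u) + (hA.expGroup t u - u) - (x - u) := by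
    rw [map_sub]; abel
  have h3 := norm_sub_le (hA.expGroup t (x - u) + (hA.expGroup t u - u)) (x - u)
  have h4 := norm_add_le (hA.expGroup t (x - u)) (hA.expGroup t u - u)
  simp only at h1
  rw [e]
  linarith

theorem isStronglyContinuousGroup_expGroup : IsStronglyContinuousGroup hA.expGroup where
  map_zero := hA.expGroup_zero
  map_add := hA.expGroup_add
  continuous_orbit x := by
    refine continuous_iff_continuousAt.2 fun t => ?_
    have h0 : Tendsto (fun s : ℝ => s - t) (𝓝 t) (𝓝 0) := by
      have : Continuous fun s : ℝ => s - t := by fun_prop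
      simpa using this.tendsto t
    have h := ((hA.expGroup t).continuous.tendsto x).comp ((hA.tendsto_expGroup_zero x).comp h0)
    refine h.congr fun s => ?_
    change (hA.expGroup t ∘L hA.expGroup (s - t)) x = hA.expGroup s x
    rw [← hA.expGroup_add, add_sub_cancel]

theorem isGeneratorOf_expGroup : IsGeneratorOf A hA.expGroup := by
  have hfwd : ∀ x y : H, (x, y) ∈ A.graph →
      Tendsto (fun h : ℝ => h⁻¹ • (hA.expGroup h x - x)) (𝓝[>] 0) (𝓝 y) := by
    intro x y hx
    rw [Metric.tendsto_nhds]
    intro ε hε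
    obtain ⟨w, hw, hyw⟩ := Metric.mem_closure_iff.1 (hA.dense_domain y) (ε / 4) (by positivity)
    have hlim : Tendsto (fun t : ℝ => t * ‖A ⟨w, hw⟩‖) (𝓝[>] 0) (𝓝 0) := by
      have : Continuous fun t : ℝ => t * ‖A ⟨w, hw⟩‖ := by fun_prop
      simpa using (this.tendsto 0).mono_left nhdsWithin_le_nhds
    filter_upwards [hlim.eventually (gt_mem_nhds (show (0 : ℝ) < ε / 4 by positivity)),
      self_mem_nhdsWithin] with t ht ht0
    have ht0 : 0 < t := ht0
    have h1 := hA.norm_expGroup_sub_sub_le ht0.le hx (A.mem_graph ⟨w, hw⟩)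
    have e : t⁻¹ • (hA.expGroup t x - x) - y = t⁻¹ • (hA.expGroup t x - x - t • y) := by
      rw [smul_sub t⁻¹ _ (t • y), inv_smul_smul₀ ht0.ne']
    rw [dist_eq_norm] at hyw ⊢
    rw [e, norm_smul, Real.norm_of_nonneg (inv_nonneg.2 ht0.le), inv_mul_lt_iff₀ ht0]
    refine h1.trans_lt ?_
    gcongr
    simp only
    linarith
  intro x y
  refine ⟨hfwd x y, fun hxy => hA.mem_graph_iff.2 fun u v huv => ?_⟩
  -- Writing `G` for the group, unitarity gives `⟪G h x - x, G h u⟫ = -⟪x, G h u - u⟫`, which turns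
  -- forward difference quotients of `x` into forward difference quotients of `u`.
  have hv := hfwd u v huv
  have hcu : Tendsto (fun h : ℝ => hA.expGroup h u) (𝓝[>] 0) (𝓝 u) :=
    (hA.tendsto_expGroup_zero u).mono_left nhdsWithin_le_nhds
  have h1 : Tendsto (fun h : ℝ => ⟪h⁻¹ • (hA.expGroup h x - x), hA.expGroup h u⟫_ℂ) (𝓝[>] 0)
      (𝓝 ⟪y, u⟫_ℂ) := hxy.inner hcu
  have h2 : Tendsto (fun h : ℝ => -⟪x, h⁻¹ • (hA.expGroup h u - u)⟫_ℂ) (𝓝[>] 0)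
      (𝓝 (-⟪x, v⟫_ℂ)) := (tendsto_const_nhds.inner hv).neg
  refine tendsto_nhds_unique h1 (h2.congr fun h => ?_)
  have hiso : ⟪hA.expGroup h x, hA.expGroup h u⟫_ℂ = ⟪x, u⟫_ℂ :=
    ContinuousLinearMap.inner_map_map_of_mem_unitary (hA.expGroup_mem_unitary h) x u
  rw [← Complex.coe_smul, ← Complex.coe_smul, inner_smul_left, inner_smul_right, inner_sub_left,
    inner_sub_right, hiso, Complex.conj_ofReal]
  ring

end IsSkewAdjoint

/-! ### A group is determined by its skew-adjoint generator -/

omit [CompleteSpace H] in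
theorem IsGeneratorOf.mem_graph_orbit {G : ℝ → H →L[ℂ] H} (hgen : IsGeneratorOf A G)
    (hG : IsStronglyContinuousGroup G) {x y : H} (hx : (x, y) ∈ A.graph) (t : ℝ) :
    (G t x, G t y) ∈ A.graph := by
  rw [hgen]
  refine (((G t).continuous.tendsto y).comp ((hgen x y).1 hx)).congr fun h => ?_
  have hcomm : G t (G h x) = G h (G t x) := by
    rw [← ContinuousLinearMap.comp_apply, ← ContinuousLinearMap.comp_apply, ← hG.map_add,
      ← hG.map_add, add_comm]
  change G t (h⁻¹ • (G h x - x)) = _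
  rw [(G t).map_smul_of_tower, map_sub, hcomm]

omit [CompleteSpace H] in
theorem IsGeneratorOf.hasDerivWithinAt_orbit {G : ℝ → H →L[ℂ] H} (hgen : IsGeneratorOf A G)
    (hG : IsStronglyContinuousGroup G) {x y : H} (hx : (x, y) ∈ A.graph) (t : ℝ) :
    HasDerivWithinAt (fun s => G s x) (G t y) (Set.Ici t) t := by
  rw [← hasDerivWithinAt_Ioi_iff_Ici, hasDerivWithinAt_iff_tendsto_slope' Set.self_notMem_Ioi]
  have h0 : Tendsto (fun s : ℝ => s - t) (𝓝[>] t) (𝓝[>] 0) := by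
    refine tendsto_nhdsWithin_iff.2 ⟨?_, ?_⟩
    · have : Continuous fun s : ℝ => s - t := by fun_prop
      simpa using (this.tendsto t).mono_left nhdsWithin_le_nhds
    · filter_upwards [self_mem_nhdsWithin] with s hs
      exact sub_pos.2 (Set.mem_Ioi.1 hs)
  refine (((hgen _ _).1 (hgen.mem_graph_orbit hG hx t)).comp h0).congr fun s => ?_
  change (s - t)⁻¹ • (G (s - t) (G t x) - G t x) = slope _ t s
  rw [← ContinuousLinearMap.comp_apply, ← hG.map_add, sub_add_cancel, slope_def_module]

/-- Two groups with generator `A` agree: the difference `u` of two orbits issuing from `D(A)` solves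
`u' = A u`, so `‖u‖²` has vanishing right derivative. -/
theorem IsSkewAdjoint.group_unique (hA : IsSkewAdjoint A) {G G' : ℝ → H →L[ℂ] H}
    (hG : IsStronglyContinuousGroup G) (hgen : IsGeneratorOf A G)
    (hG' : IsStronglyContinuousGroup G') (hgen' : IsGeneratorOf A G') : G' = G := by
  have hdom : ∀ t, 0 ≤ t → ∀ x ∈ A.domain, G' t x = G t x := by
    intro t ht x hx
    have hxy : (x, A ⟨x, hx⟩) ∈ A.graph := A.mem_graph ⟨x, hx⟩
    set u : ℝ → H := fun s => G' s x - G s x with hu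
    have hucont : Continuous u := (hG'.continuous_orbit x).sub (hG.continuous_orbit x)
    have hconst := constant_of_has_deriv_right_zero (f := fun s => ⟪u s, u s⟫_ℂ) (a := 0) (b := t)
      (hucont.inner hucont).continuousOn (fun s _ => ?_) t ⟨ht, le_rfl⟩
    · have h0 : u 0 = 0 := by simp [hu, hG.map_zero, hG'.map_zero]
      simp only [h0, inner_zero_left] at hconst
      exact sub_eq_zero.1 (inner_self_eq_zero.1 hconst)
    · have hd : HasDerivWithinAt u (G' s (A ⟨x, hx⟩) - G s (A ⟨x, hx⟩)) (Set.Ici s) s :=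
        (hgen'.hasDerivWithinAt_orbit hG' hxy s).sub (hgen.hasDerivWithinAt_orbit hG hxy s)
      have hmem : (u s, G' s (A ⟨x, hx⟩) - G s (A ⟨x, hx⟩)) ∈ A.graph :=
        A.graph.sub_mem (hgen'.mem_graph_orbit hG' hxy s) (hgen.mem_graph_orbit hG hxy s)
      have hi := hd.inner ℂ hd
      rwa [hA.inner_eq_neg hmem hmem, add_neg_cancel] at hi
  have hpos : ∀ t, 0 ≤ t → G' t = G t := fun t ht => by
    refine ContinuousLinearMap.ext fun x => ?_
    exact congrFun (Continuous.ext_on hA.dense_domain (G' t).continuous (G t).continuous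
      fun x hx => hdom t ht x hx) x
  funext t
  rcases le_total 0 t with ht | ht
  · exact hpos t ht
  -- Negative times follow by inverting the group elements.
  have hinv : G (-t) ∘L G t = 1 := by rw [← hG.map_add, neg_add_cancel, hG.map_zero]
  have hinv' : G' t ∘L G' (-t) = 1 := by rw [← hG'.map_add, add_neg_cancel, hG'.map_zero]
  calc G' t = G' t ∘L (G (-t) ∘L G t) := by rw [hinv]; rfl
    _ = (G' t ∘L G' (-t)) ∘L G t := by rw [hpos (-t) (neg_nonneg.2 ht)]; rfl
    _ = G t := by rw [hinv']; rfl

/-! ### The projected operator -/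

omit [CompleteSpace H] in
theorem moriP_apply (z x : H) : moriP z x = ((⟪z, z⟫_ℂ)⁻¹ * ⟪z, x⟫_ℂ) • z := by
  simp [moriP, smul_smul]

omit [CompleteSpace H] in
theorem moriQ_apply (z x : H) : moriQ z x = x - ((⟪z, z⟫_ℂ)⁻¹ * ⟪z, x⟫_ℂ) • z := by
  rw [moriQ, sub_apply, one_apply_eq_self, moriP_apply]

/-- `P L` is bounded on `D(L)`, being `x ↦ -(x, L z) (z, z)⁻¹ z` there. -/
theorem IsSkewAdjoint.moriQ_apply_of_mem_graph {L : H →ₗ.[ℂ] H} (hL : IsSkewAdjoint L) {z e x y : H}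
    (hz : (z, e) ∈ L.graph) (hx : (x, y) ∈ L.graph) :
    moriQ z y = y + ((⟪z, z⟫_ℂ)⁻¹ * ⟪e, x⟫_ℂ) • z := by
  rw [moriQ_apply, hL.inner_eq_neg hz hx, mul_neg, neg_smul, sub_eq_add_neg]

omit [CompleteSpace H] in
theorem mem_graph_projectedGenerator {L : H →ₗ.[ℂ] H} {z x y : H} :
    (x, y) ∈ (projectedGenerator L z).graph ↔ ∃ w, (x, w) ∈ L.graph ∧ moriQ z w = y := by
  constructor
  · rintro h
    obtain ⟨u, rfl, rfl⟩ := (LinearPMap.mem_graph_iff _).1 h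
    exact ⟨_, L.mem_graph u, rfl⟩
  · rintro ⟨w, hw, rfl⟩
    obtain ⟨u, rfl, rfl⟩ := (LinearPMap.mem_graph_iff _).1 hw
    exact (projectedGenerator L z).mem_graph u

theorem isClosed_projectedGenerator {L : H →ₗ.[ℂ] H} (hL : IsSkewAdjoint L) {z e : H}
    (hz : (z, e) ∈ L.graph) : (projectedGenerator L z).IsClosed := by
  have hset : ((projectedGenerator L z).graph : Set (H × H)) =
      (fun p : H × H => (p.1, p.2 - ((⟪z, z⟫_ℂ)⁻¹ * ⟪e, p.1⟫_ℂ) • z)) ⁻¹' L.graph := by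
    ext ⟨x, y⟩
    rw [SetLike.mem_coe, mem_graph_projectedGenerator, Set.mem_preimage, SetLike.mem_coe]
    constructor
    · rintro ⟨w, hw, rfl⟩
      rwa [hL.moriQ_apply_of_mem_graph hz hw, add_sub_cancel_right]
    · intro h
      exact ⟨_, h, by rw [hL.moriQ_apply_of_mem_graph hz h, sub_add_cancel]⟩
  rw [LinearPMap.IsClosed, hset]
  exact hL.isClosed_graph.preimage (by fun_prop)

omit [CompleteSpace H] in
theorem _root_.LinearPMap.IsClosed.closure_eq {f : H →ₗ.[ℂ] H} (hf : f.IsClosed) :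
    f.closure = f := by
  refine LinearPMap.eq_of_eq_graph ?_
  rw [← hf.isClosable.graph_closure_eq_closure_graph]
  exact hf.submodule_topologicalClosure_eq

theorem mem_graph_orthogonalGenerator {L : H →ₗ.[ℂ] H} (hL : IsSkewAdjoint L) {z e x y : H}
    (hz : (z, e) ∈ L.graph) :
    (x, y) ∈ (orthogonalGenerator L z).graph ↔ ∃ w, (moriQ z x, w) ∈ L.graph ∧ moriQ z w = y := by
  rw [← mem_graph_projectedGenerator, orthogonalGenerator,
    (isClosed_projectedGenerator hL hz).closure_eq]
  constructor
  · intro h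
    obtain ⟨u, rfl, rfl⟩ := (LinearPMap.mem_graph_iff _).1 h
    exact (projectedGenerator L z).mem_graph ⟨moriQ z u, u.2⟩
  · intro h
    obtain ⟨u, hu, rfl⟩ := (LinearPMap.mem_graph_iff _).1 h
    have hx : x ∈ (compBounded (projectedGenerator L z) (moriQ z)).domain := by
      change moriQ z x ∈ (projectedGenerator L z).domain
      exact (show (u : H) = moriQ z x from hu) ▸ u.2
    have : projectedGenerator L z u = compBounded (projectedGenerator L z) (moriQ z) ⟨x, hx⟩ :=
      congrArg (projectedGenerator L z) (Subtype.ext hu)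
    rw [this]
    exact (compBounded (projectedGenerator L z) (moriQ z)).mem_graph ⟨x, hx⟩

/-- The bounded operator by which `Q L Q` differs from `L` on `D(L)`, where `e = L z`. -/
def moriPerturbation (z e : H) : H →L[ℂ] H :=
  (⟪z, z⟫_ℂ)⁻¹ • ((innerSL ℂ e).smulRight z - (innerSL ℂ z).smulRight e) +
    ((⟪z, z⟫_ℂ)⁻¹ ^ 2 * ⟪z, e⟫_ℂ) • (innerSL ℂ z).smulRight z

omit [CompleteSpace H] in
theorem moriPerturbation_apply (z e x : H) : moriPerturbation z e x =
    (⟪z, z⟫_ℂ)⁻¹ • (⟪e, x⟫_ℂ • z - ⟪z, x⟫_ℂ • e) +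
      ((⟪z, z⟫_ℂ)⁻¹ ^ 2 * ⟪z, e⟫_ℂ) • ⟪z, x⟫_ℂ • z := rfl

theorem inner_moriPerturbation {L : H →ₗ.[ℂ] H} (hL : IsSkewAdjoint L) {z e : H}
    (hz : (z, e) ∈ L.graph) (x u : H) :
    ⟪moriPerturbation z e x, u⟫_ℂ = -⟪x, moriPerturbation z e u⟫_ℂ := by
  have h := hL.inner_eq_neg hz hz
  simp only [moriPerturbation_apply, inner_add_left, inner_add_right, inner_sub_left,
    inner_sub_right, inner_smul_left, inner_smul_right, map_mul, map_pow, map_inv₀,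
    inner_conj_symm, h]
  ring

theorem mem_graph_orthogonalGenerator_iff {L : H →ₗ.[ℂ] H} (hL : IsSkewAdjoint L) {z e x y : H}
    (hz : (z, e) ∈ L.graph) :
    (x, y) ∈ (orthogonalGenerator L z).graph ↔ (x, y - moriPerturbation z e x) ∈ L.graph := by
  rw [mem_graph_orthogonalGenerator hL hz]
  set a := (⟪z, z⟫_ℂ)⁻¹ * ⟪z, x⟫_ℂ with ha
  have hQx : moriQ z x = x - a • z := moriQ_apply z x
  have haz : (a • z, a • e) ∈ L.graph := L.graph.smul_mem a hz
  have hiff : ∀ w, (moriQ z x, w) ∈ L.graph ↔ (x, w + a • e) ∈ L.graph := by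
    intro w
    rw [hQx]
    constructor
    · intro h
      simpa using L.graph.add_mem h haz
    · intro h
      simpa using L.graph.sub_mem h haz
  have hval : ∀ w, (moriQ z x, w) ∈ L.graph →
      moriQ z w = w + a • e + moriPerturbation z e x := by
    intro w hw
    rw [hL.moriQ_apply_of_mem_graph hz hw, hQx, moriPerturbation_apply, inner_sub_right,
      inner_smul_right, hL.inner_eq_neg hz hz, ha]
    module
  constructor
  · rintro ⟨w, hw, rfl⟩
    rw [hval w hw, add_sub_cancel_right]
    exact (hiff w).1 hw
  · intro h
    have hw := (hiff (y - moriPerturbation z e x - a • e)).2 (by rwa [sub_add_cancel])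
    exact ⟨_, hw, by rw [hval _ hw]; abel⟩

/-- `Q L Q` is a bounded skew-adjoint perturbation of `L`, hence skew-adjoint. -/
theorem isSkewAdjoint_orthogonalGenerator {L : H →ₗ.[ℂ] H} (hL : IsSkewAdjoint L) {z e : H}
    (hz : (z, e) ∈ L.graph) : IsSkewAdjoint (orthogonalGenerator L z) := by
  refine isSkewAdjoint_iff_mem_graph.2 ⟨?_, fun x y => ?_⟩
  · refine hL.dense_domain.mono fun x hx => ?_
    have h : (x, L ⟨x, hx⟩ + moriPerturbation z e x) ∈ (orthogonalGenerator L z).graph := by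
      rw [mem_graph_orthogonalGenerator_iff hL hz, add_sub_cancel_right]
      exact L.mem_graph ⟨x, hx⟩
    exact LinearPMap.mem_domain_of_mem_graph h
  · rw [mem_graph_orthogonalGenerator_iff hL hz, hL.mem_graph_iff]
    have hC := inner_moriPerturbation hL hz x
    constructor
    · intro h u v huv
      have h1 := h _ _ ((mem_graph_orthogonalGenerator_iff hL hz).1 huv)
      rw [inner_sub_left, inner_sub_right, hC] at h1
      linear_combination h1
    · intro h u v huv
      have h1 := h u (v + moriPerturbation z e u)
        ((mem_graph_orthogonalGenerator_iff hL hz).2 (by rwa [add_sub_cancel_right]))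
      rw [inner_add_right] at h1
      rw [inner_sub_left, hC]
      linear_combination h1

end MoriZwanzig

end

theorem mainTheorem10 {H : Type*} [NormedAddCommGroup H] [InnerProductSpace ℂ H] [CompleteSpace H]
    (L : H →ₗ.[ℂ] H) (hL : MoriZwanzig.IsSkewAdjoint L) (z : L.domain) (hz : (z : H) ≠ 0) :
    (MoriZwanzig.projectedGenerator L (z : H)).IsClosable ∧
    ∃ G : ℝ → H →L[ℂ] H,
      MoriZwanzig.IsStronglyContinuousGroup G ∧
      MoriZwanzig.IsGeneratorOf (MoriZwanzig.orthogonalGenerator L (z : H)) G ∧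
      (∀ G' : ℝ → H →L[ℂ] H, MoriZwanzig.IsStronglyContinuousGroup G' →
        MoriZwanzig.IsGeneratorOf (MoriZwanzig.orthogonalGenerator L (z : H)) G' → G' = G) ∧
      (∀ t : ℝ, G t ∈ unitary (H →L[ℂ] H)) ∧
      ∀ r s t : ℝ,
        inner ℂ (MoriZwanzig.fluctuatingForce L z G (s + r))
            (MoriZwanzig.fluctuatingForce L z G (t + r)) =
          inner ℂ (MoriZwanzig.fluctuatingForce L z G s)
            (MoriZwanzig.fluctuatingForce L z G t) := by
  have hzg := L.mem_graph z
  have hA := MoriZwanzig.isSkewAdjoint_orthogonalGenerator hL hzg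
  refine ⟨(MoriZwanzig.isClosed_projectedGenerator hL hzg).isClosable, hA.expGroup,
    hA.isStronglyContinuousGroup_expGroup, hA.isGeneratorOf_expGroup,
    fun G' hG' hgen' => hA.group_unique hA.isStronglyContinuousGroup_expGroup
      hA.isGeneratorOf_expGroup hG' hgen', hA.expGroup_mem_unitary, fun r s t => ?_⟩
  simp only [MoriZwanzig.fluctuatingForce]
  rw [add_comm s r, add_comm t r, hA.expGroup_add, hA.expGroup_add]
  exact ContinuousLinearMap.inner_map_map_of_mem_unitary (hA.expGroup_mem_unitary r) _ _
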